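/- All graphs are finite, simple and undirected. A connected graph $G$ is $k$-connected if deleting fewer than $k$ vertices never disconnects it. For an edge colouring of $G$ (not necessarily proper), a rainbow path is a path no two of whose edges have the same colour, and the colouring is a rainbow colouring if every two vertices of $G$ are joined by a rainbow path. The rainbow connection number $rc(G)$ is the least number of colours in a rainbow colouring of $G$, and $\mathrm{diam}(G)$ is the largest distance between two vertices of $G$. Theorem. Let $G$ be a $\kappa$-connected graph on $n$ vertices with $\mathrm{diam}(G) = \frac{n}{\kappa} - c$, where $c \ge 0$ is a real number. (i) If $\kappa = 3$, then $rc(G) \le \frac{n}{3} + 11c + 6$. (ii) If $\kappa = 4$, then $rc(G) \le \frac{n}{4} + 15c + 18$. -/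

import Mathlib

namespace SimpleGraph

variable {V : Type*}

/-- `G` is `k`-(vertex-)connected: it is connected, and deleting fewer than `k` vertices does not
disconnect it. No lower bound on the number of vertices is imposed, so a complete graph is
`k`-connected for every `k`; for all other graphs this agrees with the convention that also asks
for more than `k` vertices. -/
def IsVertexConnected (G : SimpleGraph V) (k : ℕ) : Prop :=
  G.Connected ∧ ∀ S : Finset V, S.card < k → (G.induce ((S : Set V)ᶜ)).Preconnected

/-- Given an edge colouring `C` of `G` (not necessarily proper), the walk `p` is a rainbow path:
it is a path, and no two of its edges have the same colour. -/
def IsRainbowPath {G : SimpleGraph V} {K : Type*} (C : G.edgeSet → K) {u v : V}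
    (p : G.Walk u v) : Prop :=
  p.IsPath ∧ ∀ e f : G.edgeSet, (e : Sym2 V) ∈ p.edges → (f : Sym2 V) ∈ p.edges → C e = C f → e = f

/-- The edge colouring `C` is a rainbow colouring of `G`: every pair of vertices is connected by
a rainbow path. -/
def IsRainbowColoring {G : SimpleGraph V} {K : Type*} (C : G.edgeSet → K) : Prop :=
  ∀ u v : V, ∃ p : G.Walk u v, IsRainbowPath C p

/-- The rainbow connection number of `G`: the least `k` such that `G` has a rainbow colouring
with colours from a set of size `k`. -/
noncomputable def rainbowConnectionNumber (G : SimpleGraph V) : ℕ :=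
  sInf {k : ℕ | ∃ C : G.edgeSet → Fin k, IsRainbowColoring C}

/-- On a finite connected graph the minimum defining the rainbow connection number is attained. -/
theorem exists_isRainbowColoring_rainbowConnectionNumber [Finite V] {G : SimpleGraph V}
    (hG : G.Connected) :
    ∃ C : G.edgeSet → Fin G.rainbowConnectionNumber, IsRainbowColoring C := by
  classical
  have hne : {k : ℕ | ∃ C : G.edgeSet → Fin k, IsRainbowColoring C}.Nonempty := by
    obtain ⟨k, ⟨C⟩⟩ := Finite.exists_equiv_fin G.edgeSet
    refine ⟨k, C, fun u v => ?_⟩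
    obtain ⟨p, hp⟩ := hG.exists_isPath u v
    exact ⟨p, hp, fun e f _ _ h => C.injective h⟩
  exact Nat.sInf_mem hne

end SimpleGraph

/-! Let `d` be the diameter, attained by `u` and `v`, and let `n` be the number of vertices. When `d
≥ 2`, Menger's theorem gives `κ` internally disjoint paths from `u` to `v`; take them of least total
length. Each has length at least `d`. If the longest has length `M` and `r` vertices lie on no path,
counting vertices gives `r + (M - d) ≤ n - κ (d - 1) - 2`.

Colour two paths increasingly from `u` and the others decreasingly, with `M` colours. Points on
paths of opposite type are joined by a rainbow path through `u` or through `v`. For points on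
different paths of the same type, it suffices to cross first to a third path by one edge of an extra
colour: as `κ ≤ 4`, each type has at most two paths.

Privately coloured edges bring every vertex to an endpoint or to a point where crossing is possible.
Each outer vertex needs one such edge. By 3-connectivity and minimality, at most three internal
vertices per outer vertex cannot cross, and each of these needs one private edge along its path.
Hence `rc ≤ M + 1 + 4 r` (`rainbowConnectionNumber_le_four_mul`), which with the vertex count gives
`rc ≤ d + 4 (n - κ (d - 1)) - 7`. -/

namespace SimpleGraph

variable {V : Type*}

/-! ### Menger's theorem from Hall's theorem -/

/-- The steps out of a token (`Sum.inl`) or a vertex (`Sum.inr`) in the bipartite graph whose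
perfect matchings encode `k` internally disjoint walks from `u` to `v`: a token enters a neighbour
of `u`, a vertex stays in place or moves to a neighbour other than `u` and `v`, and a neighbour of
`v` may return to any token. -/
def LinkStep (G : SimpleGraph V) (u v : V) (k : ℕ) : Fin k ⊕ V → Fin k ⊕ V → Prop
  | .inl _, .inl _ => False
  | .inl _, .inr w => G.Adj u w
  | .inr w, .inl _ => G.Adj w v
  | .inr w, .inr w' => w = w' ∨ G.Adj w w' ∧ w ≠ u ∧ w ≠ v ∧ w' ≠ u ∧ w' ≠ v

/-- If no set of fewer than `k` vertices separates the nonadjacent vertices `u` and `v`, then Hall's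
condition provides an injective choice of steps. -/
theorem exists_injective_linkStep [Fintype V] (G : SimpleGraph V) {u v : V} {k : ℕ}
    (huv : ¬ G.Adj u v)
    (hsep : ∀ S : Finset V, u ∉ S → v ∉ S → S.card < k →
      ∃ p : G.Walk u v, ∀ x ∈ p.support, x ∉ S) (hne : u ≠ v) :
    ∃ f : Fin k ⊕ V → Fin k ⊕ V, Function.Injective f ∧ ∀ x, G.LinkStep u v k x (f x) := by
  classical
  have key := (Finset.all_card_le_biUnion_card_iff_exists_injective
    (fun x : Fin k ⊕ V => Finset.univ.filter (fun y => G.LinkStep u v k x y))).1 ?_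
  · obtain ⟨f, hf, h⟩ := key
    exact ⟨f, hf, fun x => (Finset.mem_filter.1 (h x)).2⟩
  intro X
  set N := X.biUnion (fun x : Fin k ⊕ V => Finset.univ.filter (fun y => G.LinkStep u v k x y))
    with hN
  have memN : ∀ y, y ∈ N ↔ ∃ x ∈ X, G.LinkStep u v k x y := by
    intro y; simp [hN]
  have hstay : ∀ y : V, Sum.inr y ∈ X → Sum.inr y ∈ N := fun y hy =>
    (memN _).2 ⟨_, hy, Or.inl rfl⟩
  have hcardX : X.card = X.toLeft.card + X.toRight.card := (X.card_toLeft_add_card_toRight).symm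
  have hcardN : N.card = N.toLeft.card + N.toRight.card := (N.card_toLeft_add_card_toRight).symm
  have hsub : X.toRight ⊆ N.toRight := fun y hy => by
    simp only [Finset.mem_toRight] at hy ⊢
    exact hstay y hy
  have hright := Finset.card_le_card hsub
  -- A vertex of `X` adjacent to `v` can step to every token, so tokens cannot obstruct Hall's
  -- condition.
  by_cases hB : ∃ y, Sum.inr y ∈ X ∧ G.Adj y v
  · obtain ⟨y, hy, hyv⟩ := hB
    have : N.toLeft = Finset.univ := by
      ext j
      simp only [Finset.mem_toLeft, Finset.mem_univ, iff_true]
      exact (memN _).2 ⟨_, hy, hyv⟩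
    have h2 : X.toLeft.card ≤ N.toLeft.card := by
      rw [this]; exact Finset.card_le_univ _
    omega
  by_cases hA : X.toLeft = ∅
  · rw [hA, Finset.card_empty] at hcardX
    omega
  obtain ⟨i, hi⟩ := Finset.nonempty_iff_ne_empty.2 hA
  rw [Finset.mem_toLeft] at hi
  -- In the remaining case `S`, the set of newly reached vertices, separates `u` from `v`: a walk
  -- from `u` avoiding `S` visits only `u` and vertices of `X`, none adjacent to `v`. So `S` has at
  -- least `k` elements, which pays for the tokens of `X`.
  set S : Finset V := N.toRight \ (X.toRight ∪ {u, v}) with hS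
  have hSk : k ≤ S.card := by
    by_contra hlt
    obtain ⟨p, hp⟩ := hsep S (by simp [hS]) (by simp [hS]) (not_le.1 hlt)
    have walk : ∀ (x z : V) (q : G.Walk x z), z = v →
        (x = u ∨ Sum.inr x ∈ X ∧ x ≠ u ∧ x ≠ v) → ∃ y ∈ q.support, y ∈ S := by
      intro x z q
      induction q with
      | nil =>
        rintro rfl (h | h)
        · exact absurd h.symm hne
        · exact absurd rfl h.2.2
      | @cons x y z hxy q ih =>
        intro hz hx
        by_cases hyS : y ∈ S
        · exact ⟨y, by simp, hyS⟩
        have hyv : y ≠ v := by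
          rintro rfl
          rcases hx with rfl | hx
          · exact huv hxy
          · exact hB ⟨x, hx.1, hxy⟩
        have hyu : y = u ∨ Sum.inr y ∈ X ∧ y ≠ u ∧ y ≠ v := by
          by_cases hyu : y = u
          · exact Or.inl hyu
          refine Or.inr ⟨?_, hyu, hyv⟩
          by_contra hyX
          apply hyS
          have hyN : Sum.inr y ∈ N := by
            rcases hx with rfl | hx
            · exact (memN _).2 ⟨_, hi, hxy⟩
            · exact (memN _).2 ⟨_, hx.1, Or.inr ⟨hxy, hx.2.1, hx.2.2, hyu, hyv⟩⟩
          simp [hS, hyN, hyX, hyu, hyv]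
        obtain ⟨t, ht, htS⟩ := ih hz hyu
        exact ⟨t, by simp [ht], htS⟩
    obtain ⟨y, hy, hyS⟩ := walk u v p rfl (Or.inl rfl)
    exact hp y hy hyS
  have hdisj : S.card + X.toRight.card ≤ N.toRight.card := by
    rw [← Finset.card_union_of_disjoint]
    · exact Finset.card_le_card (Finset.union_subset (Finset.sdiff_subset) hsub)
    · exact Finset.disjoint_left.2 fun y hy hy' => by
        simp only [hS, Finset.mem_sdiff, Finset.mem_union, not_or] at hy
        exact hy.2.1 hy'
  have hk : X.toLeft.card ≤ k := by simpa using Finset.card_le_univ X.toLeft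
  omega

/-- **Menger's theorem**: if no set of fewer than `k` vertices separates the nonadjacent vertices
`u` and `v`, then there are `k` internally disjoint walks from `u` to `v`. -/
theorem exists_internally_disjoint_walks [Fintype V] (G : SimpleGraph V) {u v : V} {k : ℕ}
    (hne : u ≠ v) (huv : ¬ G.Adj u v)
    (hsep : ∀ S : Finset V, u ∉ S → v ∉ S → S.card < k →
      ∃ p : G.Walk u v, ∀ x ∈ p.support, x ∉ S) :
    ∃ p : Fin k → G.Walk u v, ∀ a b x, x ∈ (p a).support → x ∈ (p b).support → a ≠ b →
      x = u ∨ x = v := by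
  classical
  obtain ⟨f, hf, hstep⟩ := G.exists_injective_linkStep huv hsep hne
  -- An injective self-map of a finite type is a permutation, so every orbit is a cycle. The walk of
  -- a token follows its orbit until the first return to a token.
  have hret : ∀ i : Fin k, ∃ n, 0 < n ∧ ∃ j : Fin k, f^[n] (Sum.inl i) = Sum.inl j := fun i => by
    obtain ⟨n, hn, h⟩ := hf.mem_periodicPts (Sum.inl i)
    exact ⟨n, hn, i, h⟩
  have hsucc : ∀ (n : ℕ) i, G.LinkStep u v k (f^[n] (Sum.inl i)) (f^[n + 1] (Sum.inl i)) := by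
    intro n i
    rw [Function.iterate_succ_apply']
    exact hstep _
  have hwalk : ∀ i n, (∀ m, 0 < m → m ≤ n → ∀ j : Fin k, f^[m] (Sum.inl i) ≠ Sum.inl j) →
      ∀ w, f^[n] (Sum.inl i) = Sum.inr w → ∃ q : G.Walk u w, ∀ x ∈ q.support, x ≠ u →
        ∃ m, 0 < m ∧ m ≤ n ∧ f^[m] (Sum.inl i) = Sum.inr x := by
    intro i n
    induction n with
    | zero => intro _ w hw; simp at hw
    | succ n ih =>
      intro hn w hw
      rcases Nat.eq_zero_or_pos n with rfl | hpos
      · have h := hsucc 0 i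
        rw [hw] at h
        have h' : G.Adj u w := h
        refine ⟨h'.toWalk, fun x hx hxu => ?_⟩
        have : x = w := by simpa [hxu] using hx
        exact ⟨1, one_pos, le_rfl, this ▸ hw⟩
      · rcases hy : f^[n] (Sum.inl i) with j | y
        · exact absurd hy (hn n hpos (by omega) j)
        obtain ⟨q, hq⟩ := ih (fun m h0 hm => hn m h0 (by omega)) y hy
        have h := hsucc n i
        rw [hw, hy] at h
        rcases h with h | h
        · subst h
          refine ⟨q, fun x hx hxu => ?_⟩
          obtain ⟨m, h0, hm, e⟩ := hq x hx hxu
          exact ⟨m, h0, by omega, e⟩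
        · refine ⟨q.concat h.1, fun x hx hxu => ?_⟩
          rw [Walk.support_concat, List.mem_append] at hx
          rcases hx with hx | hx
          · obtain ⟨m, h0, hm, e⟩ := hq x hx hxu
            exact ⟨m, h0, by omega, e⟩
          · exact ⟨n + 1, by omega, le_rfl, (List.mem_singleton.1 hx) ▸ hw⟩
  have hfull : ∀ i : Fin k, ∃ q : G.Walk u v, ∀ x ∈ q.support, x ≠ u → x ≠ v →
      ∃ m, 0 < m ∧ (∀ l, 0 < l → l ≤ m → ∀ j : Fin k, f^[l] (Sum.inl i) ≠ Sum.inl j) ∧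
        f^[m] (Sum.inl i) = Sum.inr x := by
    intro i
    obtain ⟨h0, j, hj⟩ := Nat.find_spec (hret i)
    have hmin : ∀ l, 0 < l → l < Nat.find (hret i) → ∀ j : Fin k,
        f^[l] (Sum.inl i) ≠ Sum.inl j := fun l hl hlt j e => Nat.find_min (hret i) hlt ⟨hl, j, e⟩
    generalize Nat.find (hret i) = N at h0 hj hmin
    obtain ⟨n, rfl⟩ : ∃ n, N = n + 1 := ⟨N - 1, by omega⟩
    have h := hsucc n i
    rw [hj] at h
    rcases hy : f^[n] (Sum.inl i) with j' | y
    · rw [hy] at h; exact h.elim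
    rw [hy] at h
    have h' : G.Adj y v := h
    obtain ⟨q, hq⟩ := hwalk i n (fun m h0 hm => hmin m h0 (by omega)) y hy
    refine ⟨q.concat h', fun x hx hxu hxv => ?_⟩
    rw [Walk.support_concat, List.mem_append] at hx
    rcases hx with hx | hx
    · obtain ⟨m, h0, hm, e⟩ := hq x hx hxu
      exact ⟨m, h0, fun l hl hlm => hmin l hl (by omega), e⟩
    · exact absurd (List.mem_singleton.1 hx) hxv
  choose p hp using hfull
  -- If two orbits meet, cancelling `f^[m]` shows that the longer one passed through the token `a`
  -- before its first return, unless `m = n` and the tokens agree.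
  have hle : ∀ (a b : Fin k) m n, m ≤ n →
      (∀ l, 0 < l → l ≤ n → ∀ j : Fin k, f^[l] (Sum.inl b) ≠ Sum.inl j) → 0 < m →
      f^[m] (Sum.inl a) = f^[n] (Sum.inl b) → a = b := by
    intro a b m n hmn hn hm e
    obtain ⟨d, rfl⟩ := Nat.exists_eq_add_of_le hmn
    rw [Function.iterate_add_apply] at e
    have e' := hf.iterate m e
    rcases Nat.eq_zero_or_pos d with rfl | hd
    · simpa using e'
    · exact absurd e'.symm (hn d hd (by omega) a)
  refine ⟨p, fun a b x ha hb hab => ?_⟩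
  by_contra hx
  push Not at hx
  obtain ⟨m, hm, hm', em⟩ := hp a x ha hx.1 hx.2
  obtain ⟨n, hn, hn', en⟩ := hp b x hb hx.1 hx.2
  rcases le_total m n with h | h
  · exact hab (hle a b m n h hn' hm (em.trans en.symm))
  · exact hab (hle b a n m h hm' hn (en.trans em.symm)).symm

/-! ### Shortest systems of disjoint paths -/

/-- `k` internally disjoint walks from `u` to `v`, each of which is geodesic in the subgraph induced
by its own vertices and the vertices outside of all the walks. -/
structure GeodesicLinkage (G : SimpleGraph V) (u v : V) (k : ℕ) where
  path : Fin k → G.Walk u v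
  disjoint : ∀ a b x, x ∈ (path a).support → x ∈ (path b).support → a ≠ b → x = u ∨ x = v
  geodesic : ∀ a i j, i ≤ j → j ≤ (path a).length →
    ∀ q : G.Walk ((path a).getVert i) ((path a).getVert j),
      (∀ x ∈ q.support, x ∈ (path a).support ∨ ∀ b, x ∉ (path b).support) → j - i ≤ q.length

/-- Internally disjoint walks of least total length form a geodesic linkage. -/
theorem GeodesicLinkage.nonempty_of_walks {G : SimpleGraph V} {u v : V} {k : ℕ}
    (h : ∃ p : Fin k → G.Walk u v, ∀ a b x, x ∈ (p a).support → x ∈ (p b).support → a ≠ b →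
      x = u ∨ x = v) : Nonempty (G.GeodesicLinkage u v k) := by
  classical
  have hex : ∃ n, ∃ p : Fin k → G.Walk u v, (∀ a b x, x ∈ (p a).support → x ∈ (p b).support →
      a ≠ b → x = u ∨ x = v) ∧ ∑ a, (p a).length = n := by
    obtain ⟨p, hp⟩ := h
    exact ⟨_, p, hp, rfl⟩
  obtain ⟨p, hp, hsum⟩ := Nat.find_spec hex
  have hmin : ∀ p' : Fin k → G.Walk u v, (∀ a b x, x ∈ (p' a).support → x ∈ (p' b).support →
      a ≠ b → x = u ∨ x = v) → ∑ a, (p a).length ≤ ∑ a, (p' a).length := fun p' hp' =>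
    hsum ▸ Nat.find_min' hex ⟨p', hp', rfl⟩
  refine ⟨⟨p, hp, fun a i j hij hj q hq => ?_⟩⟩
  -- Splicing `q` in place of the segment from `i` to `j` keeps the walks internally disjoint, so
  -- minimality forbids any gain in length.
  set r : G.Walk u v := ((p a).take i).append (q.append ((p a).drop j)) with hr
  have hrsupp : ∀ x ∈ r.support, x ∈ (p a).support ∨ ∀ b, x ∉ (p b).support := by
    intro x hx
    rw [hr, Walk.mem_support_append_iff, Walk.mem_support_append_iff] at hx
    rcases hx with hx | hx | hx
    · rw [Walk.support_take] at hx
      exact Or.inl (List.mem_of_mem_take hx)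
    · exact hq x hx
    · rw [Walk.drop_support_eq_support_drop_min] at hx
      exact Or.inl (List.mem_of_mem_drop hx)
  have hrlen : r.length = i + (q.length + ((p a).length - j)) := by
    rw [hr, Walk.length_append, Walk.length_append, Walk.take_length, Walk.drop_length,
      min_eq_left (hij.trans hj)]
  have hle := hmin (Function.update p a r) ?_
  · rw [← Finset.add_sum_erase _ _ (Finset.mem_univ a),
      ← Finset.add_sum_erase (a := a) _ (fun b => (Function.update p a r b).length)
        (Finset.mem_univ a)] at hle
    have : ∑ x ∈ Finset.univ.erase a, (Function.update p a r x).length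
        = ∑ x ∈ Finset.univ.erase a, (p x).length :=
      Finset.sum_congr rfl fun b hb => by
        rw [Function.update_of_ne (Finset.ne_of_mem_erase hb)]
    rw [this, Function.update_self] at hle
    omega
  · have hmain : ∀ b x, a ≠ b → x ∈ r.support → x ∈ (p b).support → x = u ∨ x = v := by
      intro b x hab hx hb
      rcases hrsupp x hx with h | h
      · exact hp a b x h hb hab
      · exact absurd hb (h b)
    intro b c x hb hc hbc
    by_cases hba : b = a
    · subst hba
      rw [Function.update_self] at hb
      rw [Function.update_of_ne (Ne.symm hbc)] at hc
      exact hmain c x hbc hb hc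
    · rw [Function.update_of_ne hba] at hb
      by_cases hca : c = a
      · subst hca
        rw [Function.update_self] at hc
        exact hmain b x (Ne.symm hba) hc hb
      · rw [Function.update_of_ne hca] at hc
        exact hp b c x hb hc hbc

/-- A `k`-connected finite graph has a geodesic linkage between any two nonadjacent vertices. -/
theorem IsVertexConnected.nonempty_geodesicLinkage [Fintype V] {G : SimpleGraph V} {k : ℕ}
    (hG : G.IsVertexConnected k) {u v : V} (hne : u ≠ v) (huv : ¬ G.Adj u v) :
    Nonempty (G.GeodesicLinkage u v k) := by
  refine GeodesicLinkage.nonempty_of_walks (G.exists_internally_disjoint_walks hne huv ?_)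
  intro S hu hv hS
  obtain ⟨q⟩ := hG.2 S hS ⟨u, by simpa using hu⟩ ⟨v, by simpa using hv⟩
  refine ⟨q.map (Embedding.induce _).toHom, fun x hx => ?_⟩
  replace hx : x ∈ q.support.map (Embedding.induce (G := G) ((S : Set V)ᶜ)).toHom := by
    rw [← Walk.support_map]
    exact hx
  obtain ⟨y, -, rfl⟩ := List.mem_map.1 hx
  exact fun h => y.2 (Finset.mem_coe.2 h)

/-- In a `k`-connected graph with `k ≥ 3` every vertex has a neighbour outside of a given pair,
provided that some further vertex exists. -/
theorem IsVertexConnected.exists_adj_notMem_pair {G : SimpleGraph V} {k : ℕ}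
    (hG : G.IsVertexConnected k) (hk : 3 ≤ k) {x y z t : V} (hxy : x ≠ y) (hxz : x ≠ z)
    (htx : t ≠ x) (hty : t ≠ y) (htz : t ≠ z) : ∃ w, G.Adj x w ∧ w ≠ y ∧ w ≠ z := by
  classical
  have hS : ({y, z} : Finset V).card < k := Finset.card_le_two.trans_lt (by omega)
  obtain ⟨q⟩ := hG.2 {y, z} hS ⟨x, by simp [hxy, hxz]⟩ ⟨t, by simp [hty, htz]⟩
  cases q with
  | nil => exact absurd rfl htx
  | @cons _ w _ h _ =>
    have hw := w.2
    simp only [Finset.coe_insert, Finset.coe_singleton, Set.mem_compl_iff, Set.mem_insert_iff,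
      Set.mem_singleton_iff, not_or] at hw
    exact ⟨w, h, hw⟩

namespace GeodesicLinkage

variable {G : SimpleGraph V} {u v : V} {k : ℕ} (L : G.GeodesicLinkage u v k)

/-- The vertices outside of all the paths of the linkage. -/
def Outer (x : V) : Prop := ∀ a, x ∉ (L.path a).support

/-- The internal vertices of the path `a` of the linkage. -/
def Inner (a : Fin k) (x : V) : Prop := x ∈ (L.path a).support ∧ x ≠ u ∧ x ≠ v

/-- A repeated vertex would allow the segment between its occurrences to be replaced by the empty
walk. -/
theorem getVert_injOn {a : Fin k} {i j : ℕ} (hi : i ≤ (L.path a).length)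
    (hj : j ≤ (L.path a).length) (h : (L.path a).getVert i = (L.path a).getVert j) : i = j := by
  have key : ∀ i j, i ≤ j → j ≤ (L.path a).length →
      (L.path a).getVert i = (L.path a).getVert j → i = j := by
    intro i j hij hj h
    have := L.geodesic a i j hij hj (Walk.nil.copy rfl h) (fun x hx => by
      simp only [Walk.support_copy, Walk.support_nil, List.mem_singleton] at hx
      exact Or.inl (hx ▸ Walk.getVert_mem_support _ _))
    simp at this
    omega
  rcases le_total i j with hij | hij
  · exact key i j hij hj h
  · exact (key j i hij hi h.symm).symm

theorem le_succ_of_adj {a : Fin k} {i j : ℕ} (hj : j ≤ (L.path a).length)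
    (h : G.Adj ((L.path a).getVert i) ((L.path a).getVert j)) : j ≤ i + 1 := by
  rcases le_total i j with hij | hij
  · have := L.geodesic a i j hij hj h.toWalk (fun x hx => by
      simp only [Adj.toWalk, Walk.support_cons, Walk.support_nil, List.mem_cons, List.not_mem_nil,
        or_false] at hx
      rcases hx with rfl | rfl <;> exact Or.inl (Walk.getVert_mem_support _ _))
    simp at this
    omega
  · omega

/-- The detour through `w` has length two and is an admissible replacement because `w` lies on no
path. -/
theorem le_add_two_of_adj {a : Fin k} {i j : ℕ} (hj : j ≤ (L.path a).length) {w : V}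
    (hw : L.Outer w) (hi : G.Adj w ((L.path a).getVert i))
    (h : G.Adj w ((L.path a).getVert j)) : j ≤ i + 2 := by
  rcases le_total i j with hij | hij
  · have := L.geodesic a i j hij hj (Walk.cons hi.symm h.toWalk) (fun x hx => by
      simp only [Adj.toWalk, Walk.support_cons, Walk.support_nil, List.mem_cons, List.not_mem_nil,
        or_false] at hx
      rcases hx with rfl | rfl | rfl
      · exact Or.inl (Walk.getVert_mem_support _ _)
      · exact Or.inr hw
      · exact Or.inl (Walk.getVert_mem_support _ _))
    simp at this
    omega
  · omega

theorem Inner.unique {a b : Fin k} {x : V} (ha : L.Inner a x) (hb : L.Inner b x) : a = b := by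
  by_contra h
  rcases L.disjoint a b x ha.1 hb.1 h with h | h
  · exact ha.2.1 h
  · exact ha.2.2 h

theorem Inner.eq_of_mem {a b : Fin k} {x : V} (ha : L.Inner a x)
    (hb : x ∈ (L.path b).support) : a = b :=
  ha.unique L ⟨hb, ha.2⟩

theorem inner_getVert {a : Fin k} {i : ℕ} (h0 : 0 < i) (hi : i < (L.path a).length) :
    L.Inner a ((L.path a).getVert i) := by
  refine ⟨Walk.getVert_mem_support _ _, fun h => ?_, fun h => ?_⟩
  · have := L.getVert_injOn hi.le (Nat.zero_le _) (h.trans (Walk.getVert_zero _).symm)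
    omega
  · have := L.getVert_injOn hi.le le_rfl (h.trans (Walk.getVert_length _).symm)
    omega

theorem Inner.exists_getVert {a : Fin k} {x : V} (h : L.Inner a x) :
    ∃ i, 0 < i ∧ i < (L.path a).length ∧ (L.path a).getVert i = x := by
  obtain ⟨i, rfl, hi⟩ := Walk.mem_support_iff_exists_getVert.1 h.1
  refine ⟨i, Nat.pos_of_ne_zero ?_, lt_of_le_of_ne hi ?_, rfl⟩
  · rintro rfl
    exact h.2.1 (Walk.getVert_zero _)
  · rintro rfl
    exact h.2.2 (Walk.getVert_length _)

theorem two_le_length (hne : u ≠ v) (huv : ¬ G.Adj u v) (a : Fin k) :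
    2 ≤ (L.path a).length := by
  by_contra h
  have h' : (L.path a).length = 0 ∨ (L.path a).length = 1 := by omega
  rcases h' with h | h
  · exact hne (Walk.eq_of_length_eq_zero h)
  · exact huv (Walk.adj_of_length_eq_one h)

/-- An outer vertex has at most three neighbours on each path. -/
theorem card_adj_le_three [Fintype V] [DecidableEq V] {w : V} (hw : L.Outer w) (a : Fin k)
    (s : Finset V) (hs : ∀ x ∈ s, x ∈ (L.path a).support ∧ G.Adj x w) : s.card ≤ 3 := by
  rcases s.eq_empty_or_nonempty with rfl | ⟨x, hx⟩
  · simp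
  have hex : ∃ i, i ≤ (L.path a).length ∧ (L.path a).getVert i ∈ s := by
    obtain ⟨i, rfl, hi⟩ := Walk.mem_support_iff_exists_getVert.1 (hs x hx).1
    exact ⟨i, hi, hx⟩
  obtain ⟨hi, his⟩ := Nat.find_spec hex
  have hmin : ∀ j, j ≤ (L.path a).length → (L.path a).getVert j ∈ s → Nat.find hex ≤ j :=
    fun j hj hjs => Nat.find_min' hex ⟨hj, hjs⟩
  generalize Nat.find hex = i at hi his hmin
  refine (Finset.card_le_card (t := {(L.path a).getVert i, (L.path a).getVert (i + 1),
    (L.path a).getVert (i + 2)}) fun y hy => ?_).trans Finset.card_le_three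
  obtain ⟨j, rfl, hj⟩ := Walk.mem_support_iff_exists_getVert.1 (hs y hy).1
  have h1 := hmin j hj hy
  have h2 := L.le_add_two_of_adj hj hw (hs _ his).2.symm (hs _ hy).2.symm
  obtain rfl | rfl | rfl : j = i ∨ j = i + 1 ∨ j = i + 2 := by omega
  all_goals simp

/-- In a `k`-connected graph with `k ≥ 3`, every internal vertex of a path of the linkage has a
neighbour outside of the path. -/
theorem Inner.exists_adj_notMem (hG : G.IsVertexConnected k) (hk : 3 ≤ k) (hne : u ≠ v)
    (huv : ¬ G.Adj u v) {a : Fin k} {x : V} (hx : L.Inner a x) :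
    ∃ y, G.Adj x y ∧ y ∉ (L.path a).support := by
  obtain ⟨i, h0, hi, rfl⟩ := hx.exists_getVert
  obtain ⟨i, rfl⟩ : ∃ j, i = j + 1 := ⟨i - 1, by omega⟩
  obtain ⟨b, hb⟩ : ∃ b : Fin k, b ≠ a := by
    by_cases h : a = ⟨0, by omega⟩
    · exact ⟨⟨1, by omega⟩, fun h' => by rw [h] at h'; simp at h'⟩
    · exact ⟨_, fun h' => h h'.symm⟩
  have ht : L.Inner b ((L.path b).getVert 1) :=
    L.inner_getVert one_pos (by have := L.two_le_length hne huv b; omega)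
  have hta : ∀ j, (L.path b).getVert 1 ≠ (L.path a).getVert j := fun j h =>
    hb (ht.eq_of_mem L (h ▸ Walk.getVert_mem_support _ _))
  -- Exclude the two neighbours along the path; a vertex of another path supplies the required
  -- further vertex. The neighbour obtained cannot be on the path, since it would give a chord.
  obtain ⟨y, hy, hy1, hy2⟩ := hG.exists_adj_notMem_pair (x := (L.path a).getVert (i + 1))
    (y := (L.path a).getVert i) (z := (L.path a).getVert (i + 2)) hk
    (fun h => by have := L.getVert_injOn (by omega) (by omega) h; omega)
    (fun h => by have := L.getVert_injOn (by omega) (by omega) h; omega)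
    (hta _) (hta _) (hta _)
  refine ⟨y, hy, fun hmem => ?_⟩
  obtain ⟨j, rfl, hj⟩ := Walk.mem_support_iff_exists_getVert.1 hmem
  have h1 := L.le_succ_of_adj hj hy
  have h2 := L.le_succ_of_adj hi.le hy.symm
  obtain rfl | rfl | rfl : j = i ∨ j = i + 1 ∨ j = i + 2 := by omega
  · exact hy1 rfl
  · exact hy.ne rfl
  · exact hy2 rfl

open Classical in
/-- The endpoints, the internal vertices and the outer vertices are distinct. -/
theorem card_outer_add_sum_le [Fintype V] (hne : u ≠ v) (hk : 0 < k) :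
    (Finset.univ.filter L.Outer).card + 2 + ∑ a, ((L.path a).length - 1) ≤ Fintype.card V := by
  have hinn : ∀ s : Σ a, Fin ((L.path a).length - 1),
      L.Inner s.1 ((L.path s.1).getVert (s.2 + 1)) := fun s =>
    L.inner_getVert (by omega) (by omega)
  have h : Function.Injective (Sum.elim (fun w : {x // L.Outer x} => (w : V))
      (Sum.elim (fun b : Bool => if b then u else v)
        (fun s : Σ a, Fin ((L.path a).length - 1) => (L.path s.1).getVert (s.2 + 1)))) := by
    refine Subtype.val_injective.sumElim (Function.Injective.sumElim ?_ ?_ ?_) ?_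
    · rintro (_ | _) (_ | _) h <;> simp_all
    · rintro ⟨a, i⟩ ⟨b, j⟩ h
      replace h : (L.path a).getVert (i + 1) = (L.path b).getVert (j + 1) := h
      have hi := i.2
      have hj := j.2
      obtain rfl : a = b := (hinn ⟨a, i⟩).eq_of_mem L (by
        simp only [h]
        exact Walk.getVert_mem_support _ _)
      have := L.getVert_injOn (by omega) (by omega) h
      obtain rfl : i = j := Fin.ext (by omega)
      rfl
    · rintro (_ | _) s h
      · exact (hinn s).2.2 h.symm
      · exact (hinn s).2.1 h.symm
    · rintro ⟨w, hw⟩ ((_ | _) | s) h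
      · replace h : w = v := h
        exact hw ⟨0, hk⟩ (by rw [h]; exact Walk.end_mem_support _)
      · replace h : w = u := h
        exact hw ⟨0, hk⟩ (by rw [h]; exact Walk.start_mem_support _)
      · replace h : w = (L.path s.1).getVert (s.2 + 1) := h
        exact hw s.1 (by rw [h]; exact Walk.getVert_mem_support _ _)
  have := Fintype.card_le_of_injective _ h
  rw [Fintype.card_sum, Fintype.card_sum, Fintype.card_bool, Fintype.card_sigma,
    Fintype.card_of_subtype (Finset.univ.filter L.Outer) (by simp)] at this
  simp only [Fintype.card_fin] at this
  omega

end GeodesicLinkage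

/-! ### Level colourings and rainbow paths -/

/-- An edge colouring with `N` colours, refined by giving each edge of `F` a colour of its own, is a
rainbow colouring as soon as any two vertices are joined by a walk whose edges outside of `F` have
distinct colours. -/
theorem rainbowConnectionNumber_le_add_card {G : SimpleGraph V} (lev : Sym2 V → ℕ) (N : ℕ)
    (hlev : ∀ e, lev e < N) (F : Finset (Sym2 V))
    (h : ∀ x y, ∃ q : G.Walk x y, Set.InjOn lev ({e | e ∈ q.edges} \ F)) :
    G.rainbowConnectionNumber ≤ N + F.card := by
  classical
  let K := Fin N ⊕ F
  let C : G.edgeSet → K := fun e =>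
    if he : (e : Sym2 V) ∈ F then Sum.inr ⟨e, he⟩ else Sum.inl ⟨lev e, hlev e⟩
  have hK : Fintype.card K = N + F.card := by simp [K]
  let φ : K ≃ Fin (N + F.card) := (Fintype.equivFin K).trans (finCongr hK)
  refine Nat.sInf_le ⟨φ ∘ C, fun x y => ?_⟩
  obtain ⟨q, hq⟩ := h x y
  refine ⟨q.bypass, q.bypass_isPath, fun e f he hf hef => ?_⟩
  have hC : C e = C f := φ.injective hef
  have he' := q.edges_bypass_subset_edges he
  have hf' := q.edges_bypass_subset_edges hf
  by_cases heF : (e : Sym2 V) ∈ F <;> by_cases hfF : (f : Sym2 V) ∈ F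
  · simp only [C, heF, hfF, dite_true] at hC
    exact Subtype.ext (Subtype.mk.inj (Sum.inr_injective hC))
  · simp [C, heF, hfF] at hC
  · simp [C, heF, hfF] at hC
  · simp only [C, heF, hfF, dite_false] at hC
    exact Subtype.ext (hq ⟨he', heF⟩ ⟨hf', hfF⟩ (congrArg Fin.val (Sum.inl_injective hC)))

/-- The edge number `i` of a walk. -/
def Walk.edgeAt {G : SimpleGraph V} {u v : V} (p : G.Walk u v) (i : ℕ) : Sym2 V :=
  s(p.getVert i, p.getVert (i + 1))

theorem Walk.exists_segment {G : SimpleGraph V} {u v : V} (p : G.Walk u v) {i j : ℕ} (hij : i ≤ j)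
    (hj : j ≤ p.length) : ∃ q : G.Walk (p.getVert i) (p.getVert j), ∀ e ∈ q.edges,
      ∃ m, i ≤ m ∧ m < j ∧ e = p.edgeAt m := by
  induction j, hij using Nat.le_induction with
  | base => exact ⟨Walk.nil, by simp⟩
  | succ j hij ih =>
    obtain ⟨q, hq⟩ := ih (by omega)
    refine ⟨q.concat (p.adj_getVert_succ (by omega)), fun e he => ?_⟩
    rw [Walk.edges_concat, List.concat_eq_append, List.mem_append, List.mem_singleton] at he
    rcases he with he | rfl
    · obtain ⟨m, h1, h2, h3⟩ := hq e he
      exact ⟨m, h1, by omega, h3⟩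
    · exact ⟨j, hij, by omega, rfl⟩

namespace GeodesicLinkage

variable {G : SimpleGraph V} {u v : V} {k : ℕ} (L : G.GeodesicLinkage u v k)

/-- The edges of the paths of the linkage. -/
def pathEdges : Set (Sym2 V) := {e | ∃ a m, m < (L.path a).length ∧ e = (L.path a).edgeAt m}

/-- As `u` and `v` are nonadjacent, each path edge has an internal endpoint, which determines its
path. This makes levels well defined. -/
theorem edgeAt_injective (hne : u ≠ v) (huv : ¬ G.Adj u v) {a b : Fin k} {m n : ℕ}
    (hm : m < (L.path a).length) (hn : n < (L.path b).length)
    (h : (L.path a).edgeAt m = (L.path b).edgeAt n) : a = b ∧ m = n := by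
  have hab : a = b := by
    by_contra hab
    have hlen := L.two_le_length hne huv a
    obtain ⟨i, hi, h0, hlt⟩ : ∃ i, (L.path a).getVert i ∈ (L.path a).edgeAt m ∧ 0 < i ∧
        i < (L.path a).length := by
      by_cases h0 : 0 < m
      · exact ⟨m, by simp [Walk.edgeAt], h0, hm⟩
      · exact ⟨m + 1, by simp [Walk.edgeAt], by omega, by omega⟩
    rw [h, Walk.edgeAt, Sym2.mem_iff] at hi
    refine hab ((L.inner_getVert h0 hlt).eq_of_mem L ?_)
    rcases hi with hi | hi <;> exact hi ▸ Walk.getVert_mem_support _ _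
  subst hab
  refine ⟨rfl, ?_⟩
  rw [Walk.edgeAt, Walk.edgeAt, Sym2.eq_iff] at h
  rcases h with ⟨h, -⟩ | ⟨h, h'⟩
  · exact L.getVert_injOn hm.le hn.le h
  · have h1 := L.getVert_injOn hm.le hn h
    have h2 := L.getVert_injOn hm hn.le h'
    omega

/-- Colour the edges of the first two paths increasingly and those of the other paths
decreasingly by numbers less than `M`, and all remaining edges by `M`. -/
theorem exists_levels (hne : u ≠ v) (huv : ¬ G.Adj u v) {M : ℕ}
    (hM : ∀ a, (L.path a).length ≤ M) : ∃ lev : Sym2 V → ℕ,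
      (∀ a m, m < (L.path a).length →
        lev ((L.path a).edgeAt m) = if (a : ℕ) < 2 then m else M - 1 - m) ∧
      (∀ e, e ∉ L.pathEdges → lev e = M) ∧ ∀ e ∈ L.pathEdges, lev e < M := by
  classical
  let lev : Sym2 V → ℕ := fun e =>
    if h : ∃ s : Fin k × ℕ, s.2 < (L.path s.1).length ∧ e = (L.path s.1).edgeAt s.2 then
      if (h.choose.1 : ℕ) < 2 then h.choose.2 else M - 1 - h.choose.2
    else M
  have h1 : ∀ a m, m < (L.path a).length →
      lev ((L.path a).edgeAt m) = if (a : ℕ) < 2 then m else M - 1 - m := by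
    intro a m hm
    have h : ∃ s : Fin k × ℕ, s.2 < (L.path s.1).length ∧
      (L.path a).edgeAt m = (L.path s.1).edgeAt s.2 := ⟨(a, m), hm, rfl⟩
    obtain ⟨ha, hm'⟩ := L.edgeAt_injective hne huv hm h.choose_spec.1 h.choose_spec.2
    simp only [lev, dif_pos h, ← ha, ← hm']
  refine ⟨lev, h1, fun e he => ?_, ?_⟩
  · exact dif_neg fun ⟨s, hs⟩ => he ⟨s.1, s.2, hs⟩
  · rintro e ⟨a, m, hm, rfl⟩
    rw [h1 a m hm]
    have := hM a
    split_ifs <;> omega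

/-- Two vertices joined by a walk along the paths whose edges have distinct levels. -/
def Linked (lev : Sym2 V → ℕ) (x y : V) : Prop :=
  ∃ q : G.Walk x y, (∀ e ∈ q.edges, e ∈ L.pathEdges) ∧ Set.InjOn lev {e | e ∈ q.edges}

theorem Linked.symm {lev : Sym2 V → ℕ} {x y : V} (h : L.Linked lev x y) : L.Linked lev y x := by
  obtain ⟨q, h1, h2⟩ := h
  exact ⟨q.reverse, by simpa using h1, by simpa using h2⟩

section Levels

variable {lev : Sym2 V → ℕ} {M : ℕ} (hM : ∀ a, (L.path a).length ≤ M)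
  (hlev : ∀ a m, m < (L.path a).length →
    lev ((L.path a).edgeAt m) = if (a : ℕ) < 2 then m else M - 1 - m)

include hM hlev

theorem linked_of_mem {a : Fin k} {x y : V} (hx : x ∈ (L.path a).support)
    (hy : y ∈ (L.path a).support) : L.Linked lev x y := by
  have key : ∀ i j, i ≤ j → j ≤ (L.path a).length →
      L.Linked lev ((L.path a).getVert i) ((L.path a).getVert j) := by
    intro i j hij hj
    obtain ⟨q, hq⟩ := (L.path a).exists_segment hij hj
    refine ⟨q, fun e he => ?_, fun e he f hf hef => ?_⟩
    · obtain ⟨m, -, h2, rfl⟩ := hq e he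
      exact ⟨a, m, by omega, rfl⟩
    · obtain ⟨m, -, h2, rfl⟩ := hq e he
      obtain ⟨n, -, h3, rfl⟩ := hq f hf
      rw [hlev a m (by omega), hlev a n (by omega)] at hef
      have := hM a
      obtain rfl : m = n := by split_ifs at hef <;> omega
      rfl
  obtain ⟨i, rfl, hi⟩ := Walk.mem_support_iff_exists_getVert.1 hx
  obtain ⟨j, rfl, hj⟩ := Walk.mem_support_iff_exists_getVert.1 hy
  rcases le_total i j with hij | hij
  · exact key i j hij hj
  · exact (key j i hij hi).symm

/-- Vertices on an increasing and on a decreasing path are linked through `u` or through `v`. -/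
theorem linked_of_lt_two_of_two_le {a b : Fin k} (ha : (a : ℕ) < 2) (hb : 2 ≤ (b : ℕ)) {x y : V}
    (hx : x ∈ (L.path a).support) (hy : y ∈ (L.path b).support) : L.Linked lev x y := by
  obtain ⟨i, rfl, hi⟩ := Walk.mem_support_iff_exists_getVert.1 hx
  obtain ⟨j, rfl, hj⟩ := Walk.mem_support_iff_exists_getVert.1 hy
  have hMa := hM a
  have hMb := hM b
  have la : ∀ m, m < (L.path a).length → lev ((L.path a).edgeAt m) = m := fun m hm => by
    rw [hlev a m hm, if_pos ha]
  have lb : ∀ m, m < (L.path b).length → lev ((L.path b).edgeAt m) = M - 1 - m := fun m hm => by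
    rw [hlev b m hm, if_neg (by omega)]
  -- Through `u`, the levels are below `i` on `a` and at least `M - j` on `b`: disjoint if `i + j ≤
  -- M`. Through `v`, they are at least `i` on `a` and below `M - j` on `b`: disjoint if `i + j >
  -- M`.
  have key : ∀ (q : G.Walk ((L.path a).getVert i) ((L.path b).getVert j)),
      (∀ e ∈ q.edges, (∃ m, m < (L.path a).length ∧ e = (L.path a).edgeAt m ∧
          (i + j ≤ M → m < i) ∧ (M < i + j → i ≤ m)) ∨
        ∃ m, m < (L.path b).length ∧ e = (L.path b).edgeAt m ∧
          (i + j ≤ M → m < j) ∧ (M < i + j → j ≤ m)) →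
      L.Linked lev ((L.path a).getVert i) ((L.path b).getVert j) := by
    intro q hq
    refine ⟨q, fun e he => ?_, fun e he f hf hef => ?_⟩
    · rcases hq e he with ⟨m, hm, rfl, -⟩ | ⟨m, hm, rfl, -⟩
      · exact ⟨a, m, hm, rfl⟩
      · exact ⟨b, m, hm, rfl⟩
    · rcases hq e he with ⟨m, hm, rfl, h1, h2⟩ | ⟨m, hm, rfl, h1, h2⟩ <;>
      rcases hq f hf with ⟨n, hn, rfl, h3, h4⟩ | ⟨n, hn, rfl, h3, h4⟩
      · rw [la m hm, la n hn] at hef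
        rw [hef]
      · rw [la m hm, lb n hn] at hef
        omega
      · rw [lb m hm, la n hn] at hef
        omega
      · rw [lb m hm, lb n hn] at hef
        obtain rfl : m = n := by omega
        rfl
  rcases le_or_gt (i + j) M with hij | hij
  · obtain ⟨q, hq⟩ := (L.path a).exists_segment (Nat.zero_le i) hi
    obtain ⟨r, hr⟩ := (L.path b).exists_segment (Nat.zero_le j) hj
    refine key ((q.copy (Walk.getVert_zero _) rfl).reverse.append
      (r.copy (Walk.getVert_zero _) rfl)) fun e he => ?_
    rw [Walk.edges_append, List.mem_append, Walk.edges_reverse, List.mem_reverse, Walk.edges_copy,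
      Walk.edges_copy] at he
    rcases he with he | he
    · obtain ⟨m, -, hm, rfl⟩ := hq e he
      exact Or.inl ⟨m, by omega, rfl, by omega, by omega⟩
    · obtain ⟨m, -, hm, rfl⟩ := hr e he
      exact Or.inr ⟨m, by omega, rfl, by omega, by omega⟩
  · obtain ⟨q, hq⟩ := (L.path a).exists_segment hi le_rfl
    obtain ⟨r, hr⟩ := (L.path b).exists_segment hj le_rfl
    refine key ((q.copy rfl (Walk.getVert_length _)).append
      (r.copy rfl (Walk.getVert_length _)).reverse) fun e he => ?_
    rw [Walk.edges_append, List.mem_append, Walk.edges_reverse, List.mem_reverse, Walk.edges_copy,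
      Walk.edges_copy] at he
    rcases he with he | he
    · obtain ⟨m, hm', hm, rfl⟩ := hq e he
      exact Or.inl ⟨m, by omega, rfl, by omega, by omega⟩
    · obtain ⟨m, hm', hm, rfl⟩ := hr e he
      exact Or.inr ⟨m, by omega, rfl, by omega, by omega⟩

theorem linked_of_eq_or_lt_two_iff {a b : Fin k} (hab : a = b ∨ ¬ ((a : ℕ) < 2 ↔ (b : ℕ) < 2))
    {x y : V} (hx : x ∈ (L.path a).support) (hy : y ∈ (L.path b).support) :
    L.Linked lev x y := by
  rcases hab with rfl | hab
  · exact L.linked_of_mem hM hlev hx hy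
  · by_cases ha : (a : ℕ) < 2
    · exact L.linked_of_lt_two_of_two_le hM hlev ha (by omega) hx hy
    · exact (L.linked_of_lt_two_of_two_le hM hlev (by omega) (by omega) hy hx).symm

end Levels

/-- A vertex of the path `a` that can be left towards another path by a walk which, apart from
edges of `F`, uses only one edge, and this edge belongs to no path. -/
def Crossing (F : Finset (Sym2 V)) (a : Fin k) (x : V) : Prop :=
  ∃ b, b ≠ a ∧ ∃ y ∈ (L.path b).support, ∃ q : G.Walk x y, ∃ e₀, e₀ ∉ L.pathEdges ∧
    ∀ e ∈ q.edges, e = e₀ ∨ e ∈ F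

/-- If there are at most four paths and every vertex is joined by edges of `F` to a vertex of the
paths that is an endpoint or a crossing, then giving the edges of `F` private colours leads to a
rainbow colouring. -/
theorem rainbowConnectionNumber_le (hne : u ≠ v) (huv : ¬ G.Adj u v) (hk : k ≤ 4) {M : ℕ}
    (hM : ∀ a, (L.path a).length ≤ M) (F : Finset (Sym2 V))
    (hF : ∀ z, ∃ t, ∃ q : G.Walk z t, (∀ e ∈ q.edges, e ∈ F) ∧ (∃ a, t ∈ (L.path a).support) ∧
      ∀ a, L.Inner a t → L.Crossing F a t) :
    G.rainbowConnectionNumber ≤ M + 1 + F.card := by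
  obtain ⟨lev, hlev, hout, hin⟩ := L.exists_levels hne huv hM
  refine rainbowConnectionNumber_le_add_card lev (M + 1) (fun e => ?_) F fun x y => ?_
  · by_cases he : e ∈ L.pathEdges
    · exact (hin e he).trans (Nat.lt_succ_self M)
    · rw [hout e he]
      exact Nat.lt_succ_self M
  obtain ⟨s, q₁, hq₁, ⟨a, ha⟩, hcr⟩ := hF x
  obtain ⟨t, q₂, hq₂, ⟨b, hb⟩, -⟩ := hF y
  -- Edges of `F` are exempt and linked walks use only levels below `M`, so there is room for one
  -- non-path edge `e₀`, of level `M`.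
  have join : ∀ s' (q : G.Walk s s') (e₀ : Sym2 V), (∀ e ∈ q.edges, e ∈ F ∨
      e = e₀ ∧ e₀ ∉ L.pathEdges) → L.Linked lev s' t →
      ∃ q : G.Walk x y, Set.InjOn lev ({e | e ∈ q.edges} \ F) := by
    rintro s' q e₀ hq ⟨r, hr, hinj⟩
    refine ⟨q₁.append (q.append (r.append q₂.reverse)), ?_⟩
    have hedge : ∀ e ∈ ({e | e ∈ (q₁.append (q.append (r.append q₂.reverse))).edges} \ F :
        Set (Sym2 V)), (e = e₀ ∧ e₀ ∉ L.pathEdges) ∨ e ∈ r.edges := by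
      rintro e ⟨he, heF⟩
      simp only [Walk.edges_append, Walk.edges_reverse, List.mem_append, List.mem_reverse,
        Set.mem_ofPred_eq] at he
      rcases he with he | he | he | he
      · exact absurd (hq₁ e he) heF
      · exact Or.inl ((hq e he).resolve_left heF)
      · exact Or.inr he
      · exact absurd (hq₂ e he) heF
    intro e he f hf hef
    rcases hedge e he with ⟨rfl, h1⟩ | h1 <;> rcases hedge f hf with ⟨rfl, h2⟩ | h2
    · rfl
    · have := hin f (hr f h2)
      have := hout e h1
      omega
    · have := hin e (hr e h1)
      have := hout f h2
      omega
    · exact hinj h1 h2 hef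
  by_cases hab : a = b ∨ ¬ ((a : ℕ) < 2 ↔ (b : ℕ) < 2)
  -- No crossing is needed here; `s(s, s)` is a dummy value for `e₀`.
  · exact join s Walk.nil s(s, s) (by simp) (L.linked_of_eq_or_lt_two_iff hM hlev hab ha hb)
  push Not at hab
  by_cases hs : s = u ∨ s = v
  · have hsb : s ∈ (L.path b).support := by
      rcases hs with rfl | rfl
      · exact Walk.start_mem_support _
      · exact Walk.end_mem_support _
    exact join s Walk.nil s(s, s) (by simp) (L.linked_of_mem hM hlev hsb hb)
  push Not at hs
  obtain ⟨c, hca, s', hs', q, e₀, he₀, hq⟩ := hcr a ⟨ha, hs⟩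
  refine join s' q e₀ (fun e he => ?_) (L.linked_of_eq_or_lt_two_iff hM hlev ?_ hs' hb)
  · rcases hq e he with h | h
    · exact Or.inr ⟨h, he₀⟩
    · exact Or.inl h
  -- Each type has at most two indices. Since `a` and `b` are distinct of the same type and `c ≠ a`,
  -- either `c = b` or `c` has the other type.
  · have := a.2
    have := b.2
    have := c.2
    have h1 := hab.2
    have h2 : (a : ℕ) ≠ b := fun h => hab.1 (Fin.ext h)
    have h3 : (c : ℕ) ≠ a := fun h => hca (Fin.ext h)
    by_cases h4 : (c : ℕ) = b
    · exact Or.inl (Fin.ext h4)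
    · right
      omega

theorem mem_support_of_mem_edgeAt {a : Fin k} {m : ℕ} {x : V} (h : x ∈ (L.path a).edgeAt m) :
    x ∈ (L.path a).support := by
  rw [Walk.edgeAt, Sym2.mem_iff] at h
  rcases h with rfl | rfl <;> exact Walk.getVert_mem_support _ _

/-! ### Private edges leading to crossings -/

/-- Every outer vertex can be given a neighbour, an inner one if possible, such that following these
neighbours leads to the paths. -/
theorem exists_parent (hG : G.Connected) (hk : 0 < k) : ∃ par : V → V, ∀ w, L.Outer w →
    G.Adj w (par w) ∧ (∀ a x, L.Inner a x → G.Adj w x → ∃ b, L.Inner b (par w)) ∧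
    ((∃ a, par w ∈ (L.path a).support) ∨ G.dist (par w) u < G.dist w u) := by
  have : ∀ w, ∃ y, L.Outer w →
      G.Adj w y ∧ (∀ a x, L.Inner a x → G.Adj w x → ∃ b, L.Inner b y) ∧
      ((∃ a, y ∈ (L.path a).support) ∨ G.dist y u < G.dist w u) := by
    intro w
    by_cases h : ∃ a x, L.Inner a x ∧ G.Adj w x
    · obtain ⟨a, x, hx, hwx⟩ := h
      exact ⟨x, fun _ => ⟨hwx, fun _ _ _ _ => ⟨a, hx⟩, Or.inl ⟨a, hx.1⟩⟩⟩
    obtain ⟨p, hp⟩ := hG.exists_walk_length_eq_dist w u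
    cases p with
    | nil => exact ⟨u, fun hw => absurd (Walk.start_mem_support _) (hw ⟨0, hk⟩)⟩
    | @cons _ y _ hwy p =>
      refine ⟨y, fun _ => ⟨hwy, fun a x hx hwx => absurd ⟨a, x, hx, hwx⟩ h, Or.inr ?_⟩⟩
      have := dist_le p
      rw [Walk.length_cons] at hp
      omega
  choose par hpar using this
  exact ⟨par, hpar⟩

/-- Relative to a choice `par` of neighbours of the outer vertices, the vertex `x` of the path `a`
has a neighbour in another path, or an outer neighbour with a `par` in another path. -/
def Escapes (par : V → V) (a : Fin k) (x : V) : Prop :=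
  (∃ b, b ≠ a ∧ ∃ y, L.Inner b y ∧ G.Adj x y) ∨
    ∃ w, L.Outer w ∧ G.Adj x w ∧ ∃ b, b ≠ a ∧ L.Inner b (par w)

/-- An edge between internal vertices of different paths, or from a path to an outer vertex, is no
path edge and serves as `e₀`; the edge from `w` to `par w` is in `F`. -/
theorem Escapes.crossing {par : V → V} {F : Finset (Sym2 V)}
    (hpar : ∀ w, L.Outer w → G.Adj w (par w)) (hF : ∀ w, L.Outer w → s(w, par w) ∈ F)
    {a : Fin k} {x : V} (hx : L.Inner a x) (h : L.Escapes par a x) : L.Crossing F a x := by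
  rcases h with ⟨b, hba, y, hy, hxy⟩ | ⟨w, hw, hxw, b, hba, hb⟩
  · refine ⟨b, hba, y, hy.1, hxy.toWalk, s(x, y), ?_, fun e he => Or.inl (by simpa using he)⟩
    rintro ⟨c, m, -, h⟩
    have hxc : x ∈ (L.path c).support := L.mem_support_of_mem_edgeAt (h ▸ Sym2.mem_mk_left _ _)
    have hyc : y ∈ (L.path c).support := L.mem_support_of_mem_edgeAt (h ▸ Sym2.mem_mk_right _ _)
    exact hba ((hy.eq_of_mem L hyc).trans (hx.eq_of_mem L hxc).symm)
  · refine ⟨b, hba, par w, hb.1, Walk.cons hxw (hpar w hw).toWalk, s(x, w), ?_, fun e he => ?_⟩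
    · rintro ⟨c, m, -, h⟩
      exact hw c (L.mem_support_of_mem_edgeAt (h ▸ Sym2.mem_mk_right _ _))
    · simp only [Adj.toWalk, Walk.edges_cons, Walk.edges_nil, List.mem_cons, List.not_mem_nil,
        or_false] at he
      rcases he with rfl | rfl
      · exact Or.inl rfl
      · exact Or.inr (hF w hw)

open Classical in
/-- There are at most three vertices that do not escape for each outer vertex. -/
theorem card_not_escapes_le [Fintype V] (hG : G.IsVertexConnected k) (hk : 3 ≤ k) (hne : u ≠ v)
    (huv : ¬ G.Adj u v) {par : V → V}
    (hpar : ∀ w, L.Outer w → ∀ a x, L.Inner a x → G.Adj w x → ∃ b, L.Inner b (par w)) :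
    (Finset.univ.filter fun x => ∃ a, L.Inner a x ∧ ¬ L.Escapes par a x).card ≤
      (Finset.univ.filter L.Outer).card * 3 := by
  -- Charge a non-escaping `x` to a neighbour `w` off its path. Then `w` is outer, and `par w` is
  -- internal to the path of `x`. So all vertices charged to `w` are its neighbours on a single
  -- path, at most three.
  refine (Finset.card_le_card (t := (Finset.univ.filter L.Outer).biUnion fun w =>
    Finset.univ.filter fun x => ∃ a, L.Inner a x ∧ L.Inner a (par w) ∧ G.Adj x w)
    fun x hx => ?_).trans (Finset.card_biUnion_le_card_mul _ _ _ fun w hw => ?_)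
  · obtain ⟨a, hxa, hesc⟩ := (Finset.mem_filter.1 hx).2
    obtain ⟨y, hxy, hya⟩ := hxa.exists_adj_notMem L hG hk hne huv
    have hy : L.Outer y := by
      intro b hb
      refine hesc (Or.inl ⟨b, fun h => hya (h ▸ hb), y, ⟨hb, ?_, ?_⟩, hxy⟩)
      · rintro rfl
        exact hya (Walk.start_mem_support _)
      · rintro rfl
        exact hya (Walk.end_mem_support _)
    obtain ⟨b, hb⟩ := hpar y hy a x hxa hxy.symm
    have hba : b = a := by
      by_contra hba
      exact hesc (Or.inr ⟨y, hy, hxy, b, hba, hb⟩)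
    subst hba
    simp only [Finset.mem_biUnion, Finset.mem_filter, Finset.mem_univ, true_and]
    exact ⟨y, hy, b, hxa, hb, hxy⟩
  · have hw' : L.Outer w := (Finset.mem_filter.1 hw).2
    by_cases h : ∃ a, L.Inner a (par w)
    · obtain ⟨a, ha⟩ := h
      refine L.card_adj_le_three hw' a _ fun x hx => ?_
      obtain ⟨b, hb, hb', hxw⟩ := (Finset.mem_filter.1 hx).2
      exact ⟨ha.unique L hb' ▸ hb.1, hxw⟩
    · rw [Finset.filter_eq_empty_iff.2 fun x _ ⟨b, _, hb, _⟩ => h ⟨b, hb⟩]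
      simp

-- The private edges are one parent edge per outer vertex and, per non-escaping internal vertex, the
-- path edge towards `u`. Following the latter ends at an escaping vertex or at `u`.
open Classical in
theorem rainbowConnectionNumber_le_four_mul [Fintype V] (hG : G.IsVertexConnected k) (hk3 : 3 ≤ k)
    (hk4 : k ≤ 4) (hne : u ≠ v) (huv : ¬ G.Adj u v) {M : ℕ} (hM : ∀ a, (L.path a).length ≤ M) :
    G.rainbowConnectionNumber ≤ M + 1 + 4 * (Finset.univ.filter L.Outer).card := by
  obtain ⟨par, hpar⟩ := L.exists_parent hG.1 (by omega)
  set R := Finset.univ.filter L.Outer with hR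
  set U := Finset.univ.filter fun x => ∃ a, L.Inner a x ∧ ¬ L.Escapes par a x with hU
  have hcardU : U.card ≤ R.card * 3 :=
    L.card_not_escapes_le hG hk3 hne huv fun w hw => (hpar w hw).2.1
  have hpred : ∀ x, ∃ y, x ∈ U → ∃ a i, i + 1 < (L.path a).length ∧
      (L.path a).getVert (i + 1) = x ∧ (L.path a).getVert i = y := by
    intro x
    by_cases hx : x ∈ U
    · obtain ⟨a, hxa, -⟩ := (Finset.mem_filter.1 hx).2
      obtain ⟨i, h0, hi, rfl⟩ := hxa.exists_getVert
      obtain ⟨i, rfl⟩ : ∃ j, i = j + 1 := ⟨i - 1, by omega⟩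
      exact ⟨_, fun _ => ⟨a, i, hi, rfl, rfl⟩⟩
    · exact ⟨x, fun h => absurd h hx⟩
  choose pred hpred using hpred
  set F := R.image (fun w => s(w, par w)) ∪ U.image (fun x => s(x, pred x)) with hFdef
  have hRF : ∀ w, L.Outer w → s(w, par w) ∈ F := fun w hw =>
    Finset.mem_union_left _ (Finset.mem_image_of_mem (fun w => s(w, par w)) (by simpa [hR] using hw))
  have hUF : ∀ x ∈ U, s(x, pred x) ∈ F := fun x hx =>
    Finset.mem_union_right _ (Finset.mem_image_of_mem (fun x => s(x, pred x)) hx)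
  have hcardF : F.card ≤ R.card + U.card :=
    (Finset.card_union_le _ _).trans (add_le_add Finset.card_image_le Finset.card_image_le)
  let Good : V → Prop := fun z => ∃ t, ∃ q : G.Walk z t, (∀ e ∈ q.edges, e ∈ F) ∧
    (∃ a, t ∈ (L.path a).support) ∧ ∀ a, L.Inner a t → L.Crossing F a t
  have hstep : ∀ z z', G.Adj z z' → s(z, z') ∈ F → Good z' → Good z := by
    rintro z z' h hF ⟨t, q, hq, ht⟩
    refine ⟨t, Walk.cons h q, fun e he => ?_, ht⟩
    rw [Walk.edges_cons, List.mem_cons] at he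
    rcases he with rfl | he
    · exact hF
    · exact hq e he
  have hbase : ∀ z a, z ∈ (L.path a).support → z ∉ U → Good z := by
    refine fun z a hz hzU => ⟨z, Walk.nil, by simp, ⟨a, hz⟩, fun b hb => ?_⟩
    refine Escapes.crossing L (fun w hw => (hpar w hw).1) hRF hb ?_
    by_contra h
    exact hzU (Finset.mem_filter.2 ⟨Finset.mem_univ _, b, hb, h⟩)
  have hpath : ∀ i a, Good ((L.path a).getVert i) := by
    intro i
    induction i with
    | zero =>
      refine fun a => hbase _ a (Walk.getVert_mem_support _ _) fun h => ?_
      obtain ⟨b, hb, -⟩ := (Finset.mem_filter.1 h).2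
      exact hb.2.1 (Walk.getVert_zero _)
    | succ i ih =>
      intro a
      by_cases h : (L.path a).getVert (i + 1) ∈ U
      · obtain ⟨b, j, hj, h1, h2⟩ := hpred _ h
        have hb := L.inner_getVert (Nat.succ_pos j) hj
        have hba : b = a := hb.eq_of_mem L (h1 ▸ Walk.getVert_mem_support _ _)
        subst hba
        have hi : i + 1 < (L.path b).length := by
          by_contra hi
          rw [h1, Walk.getVert_of_length_le _ (not_lt.1 hi)] at hb
          exact hb.2.2 rfl
        have hij : j = i := by
          have := L.getVert_injOn hj.le hi.le h1
          omega
        subst hij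
        refine hstep _ _ ((L.path b).adj_getVert_succ (by omega)).symm ?_ (ih b)
        have := hUF _ h
        rwa [← h2] at this
      · exact hbase _ a (Walk.getVert_mem_support _ _) h
  -- Parent edges reach the paths because, short of them, the distance to `u` strictly decreases.
  have hgood : ∀ n z, G.dist z u < n → Good z := by
    intro n
    induction n with
    | zero => intro z h; omega
    | succ n ih =>
      intro z hz
      have honpath : ∀ y, (∃ a, y ∈ (L.path a).support) → Good y := by
        rintro y ⟨a, ha⟩
        obtain ⟨i, rfl, -⟩ := Walk.mem_support_iff_exists_getVert.1 ha
        exact hpath i a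
      by_cases h : L.Outer z
      · obtain ⟨h1, -, h3⟩ := hpar z h
        refine hstep z _ h1 (hRF z h) ?_
        rcases h3 with h3 | h3
        · exact honpath _ h3
        · exact ih _ (by omega)
      · exact honpath z (by simpa [Outer] using h)
  have := L.rainbowConnectionNumber_le hne huv hk4 hM F fun z => hgood _ z (Nat.lt_succ_self _)
  omega

end GeodesicLinkage

/-! ### Counting vertices and the final estimate -/

theorem rainbowConnectionNumber_le_one_of_diam_le_one [Fintype V] {G : SimpleGraph V}
    (hG : G.Connected) (h : G.diam ≤ 1) : G.rainbowConnectionNumber ≤ 1 := by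
  have := hG.nonempty
  refine Nat.sInf_le ⟨fun _ => 0, fun x y => ?_⟩
  by_cases hxy : x = y
  · subst hxy
    exact ⟨Walk.nil, Walk.IsPath.nil, by simp⟩
  have hd : G.dist x y ≤ 1 := (dist_le_diam (connected_iff_ediam_ne_top.1 hG)).trans h
  have hadj : G.Adj x y := dist_eq_one_iff_adj.1 (le_antisymm hd (hG.pos_dist_of_ne hxy))
  refine ⟨hadj.toWalk, by simp [hadj.ne], fun e f he hf _ => Subtype.ext ?_⟩
  have he' : (e : Sym2 V) = s(x, y) := by simpa using he
  have hf' : (f : Sym2 V) = s(x, y) := by simpa using hf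
  rw [he', hf']

/-- The rainbow connection number exceeds the diameter by at most four times the number of vertices
in excess of the minimum forced by the diameter and the connectivity. -/
theorem IsVertexConnected.rainbowConnectionNumber_add_le [Fintype V] {G : SimpleGraph V} {k : ℕ}
    (hG : G.IsVertexConnected k) (hk3 : 3 ≤ k) (hk4 : k ≤ 4) (hdiam : 2 ≤ G.diam) :
    G.rainbowConnectionNumber + 4 * (k * (G.diam - 1)) + 7 ≤ G.diam + 4 * Fintype.card V := by
  classical
  have := hG.1.nonempty
  obtain ⟨u, v, huv⟩ := G.exists_dist_eq_diam
  have hne : u ≠ v := by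
    rintro rfl
    rw [dist_self] at huv
    omega
  have hadj : ¬ G.Adj u v := fun h => by
    rw [dist_eq_one_iff_adj.2 h] at huv
    omega
  obtain ⟨L⟩ := hG.nonempty_geodesicLinkage hne hadj
  have hlen : ∀ a, G.diam ≤ (L.path a).length := fun a => huv ▸ dist_le _
  have : Nonempty (Fin k) := ⟨⟨0, by omega⟩⟩
  obtain ⟨a, ha⟩ := Finite.exists_max fun a => (L.path a).length
  have h1 := L.rainbowConnectionNumber_le_four_mul hG hk3 hk4 hne hadj ha
  have h2 := L.card_outer_add_sum_le hne (by omega)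
  -- The longest path `a` is kept apart: its excess over the diameter adds to the number of colours
  -- only once but uses up vertices, so the factor 4 covers it too.
  have h3 : (k - 1) * (G.diam - 1) ≤
      ∑ b ∈ Finset.univ.erase a, ((L.path b).length - 1) := by
    have := Finset.card_nsmul_le_sum (Finset.univ.erase a) (fun b => (L.path b).length - 1)
      (G.diam - 1) fun b _ => Nat.sub_le_sub_right (hlen b) 1
    simpa using this
  rw [← Finset.add_sum_erase _ _ (Finset.mem_univ a)] at h2
  have h4 : k * (G.diam - 1) = (k - 1) * (G.diam - 1) + (G.diam - 1) := by
    obtain ⟨j, rfl⟩ : ∃ j, k = j + 1 := ⟨k - 1, by omega⟩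
    rw [Nat.add_sub_cancel]
    ring
  have h5 := hlen a
  omega

end SimpleGraph

theorem mainTheorem1 {V : Type*} [Fintype V] (G : SimpleGraph V) (κ : ℕ) (c : ℝ)
    (hG : G.IsVertexConnected κ) (hc : 0 ≤ c)
    (hdiam : (G.diam : ℝ) = (Fintype.card V : ℝ) / (κ : ℝ) - c) :
    (κ = 3 → (G.rainbowConnectionNumber : ℝ) ≤ (Fintype.card V : ℝ) / 3 + 11 * c + 6) ∧
    (κ = 4 → (G.rainbowConnectionNumber : ℝ) ≤ (Fintype.card V : ℝ) / 4 + 15 * c + 18) := by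
  have hn : (0 : ℝ) ≤ Fintype.card V := Nat.cast_nonneg _
  rcases le_or_gt G.diam 1 with hd | hd
  · have h : (G.rainbowConnectionNumber : ℝ) ≤ 1 := by
      exact_mod_cast G.rainbowConnectionNumber_le_one_of_diam_le_one hG.1 hd
    constructor <;> intro _ <;> linarith
  obtain ⟨d, hd'⟩ : ∃ d, G.diam = d + 1 := ⟨G.diam - 1, by omega⟩
  -- Substituting `n = κ (diam + c)` yields `n / κ + (4κ - 1) c + 4κ - 7`, with additive constants 5
  -- and 9 for `κ = 3` and `κ = 4`.
  constructor <;> rintro rfl <;>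
  · have h := hG.rainbowConnectionNumber_add_le (by norm_num) (by norm_num) hd
    rw [hd', Nat.add_sub_cancel] at h
    have h' := (Nat.cast_le (α := ℝ)).2 h
    rw [hd'] at hdiam
    push_cast at h' hdiam
    linarith
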